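/- For integers $p,k\ge 0$ let $G_0(k)=1$ and, for $p\ge 1$, $$G_p(k)=\sum_{n_1=0}^{k-1}\frac{1}{(2n_1+1)^2}\sum_{n_2=0}^{n_1-1}\frac{1}{(2n_2+1)^2}\cdots\sum_{n_p=0}^{n_{p-1}-1}\frac{1}{(2n_p+1)^2}.$$ For integers $k\ge 1$ let $H_1(k)=1$ and, for $p\ge 1$, $$H_{p+1}(k)=\sum_{n_1=1}^{k-1}\frac{1}{(2n_1)^2}\sum_{n_2=1}^{n_1-1}\frac{1}{(2n_2)^2}\cdots\sum_{n_p=1}^{n_{p-1}-1}\frac{1}{(2n_p)^2}.$$ For every integer $n\ge 0$ put $\binom{n}{n/2}=\dfrac{\Gamma(n+1)}{\Gamma(\frac n2+1)^2}$, which is the usual binomial coefficient when $n$ is even. **Theorem 4.1.** For every fixed integer $p\ge 0$, the series below converges for all integers $n\ge 0$, and as $n\to\infty$ (through all integers, even and odd), $$\frac{2^{2p+n+1}(2p)!}{\binom{n}{n/2}}\sum_{k=0}^{\infty}\frac{\binom{2k}{k}G_p(k)}{4^k(2k+n+1)}\longrightarrow \pi^{2p+1}.$$ For every fixed integer $p\ge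 1$, the series below converges for all integers $n\ge 0$, and as $n\to\infty$ (through all integers, even and odd), $$\frac{2^{2p+n-1}(2p-1)!}{\binom{n}{n/2}}\sum_{k=1}^{\infty}\frac{4^kH_p(k)}{\binom{2k}{k}\,k\,(2k+n)}\longrightarrow \pi^{2p}.$$ -/

import Mathlib

open Filter Topology

noncomputable section

/-- The `p`-fold nested sum `G_p(k)`: the sum over `k > n₁ > n₂ > ⋯ > n_p ≥ 0` of
`∏ 1 / (2 nᵢ + 1)²`, with `G_0(k) = 1`. The outermost summation index is split off. -/
def arcsinG : ℕ → ℕ → ℝ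
  | 0, _ => 1
  | p + 1, k => ∑ j ∈ Finset.range k, 1 / (2 * (j : ℝ) + 1) ^ 2 * arcsinG p j

/-- The nested sum `H_p(k)`, `p ≥ 1`: `H_1(k) = 1`, and `H_{p+1}(k)` is the sum over
`k > n₁ > n₂ > ⋯ > n_p ≥ 1` of `∏ 1 / (2 nᵢ)²`. The outermost summation index is split off.
The value at `p = 0` is a placeholder and is never used. -/
def arcsinH : ℕ → ℕ → ℝ
  | 0, _ => 0
  | 1, _ => 1
  | p + 2, k => ∑ j ∈ Finset.Ico 1 k, 1 / (2 * (j : ℝ)) ^ 2 * arcsinH (p + 1) j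

/-- The binomial coefficient `n` over `n / 2` as a real number, for every natural number `n`
(even or odd), interpreted as `Γ(n + 1) / Γ(n / 2 + 1)²`. -/
def middleBinom (n : ℕ) : ℝ :=
  Real.Gamma ((n : ℝ) + 1) / Real.Gamma ((n : ℝ) / 2 + 1) ^ 2

/-- For even arguments this is the usual central binomial coefficient. -/
theorem middleBinom_two_mul (l : ℕ) : middleBinom (2 * l) = ((2 * l).choose l : ℝ) := by
  have h : ((2 * l : ℕ) : ℝ) / 2 + 1 = (l : ℝ) + 1 := by push_cast; ring
  rw [middleBinom, h, Real.Gamma_nat_eq_factorial, Real.Gamma_nat_eq_factorial,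
    Nat.cast_choose ℝ (by omega : l ≤ 2 * l), show 2 * l - l = l by omega, sq]

end

/-! For s = 0, 1 the key identity is cos θ · ∑ c_k sin^(2k+s) θ = θ^(2p+s)/(2p+s)! on (-π/2, π/2),
where c_k is `arcsinCoeff s k * nestedSum s p k` (`cos_mul_tsum_nestedSum_eq`). It follows by
induction on p: two integrations raise the power of θ by two, and on coefficients they act as the
recurrence defining the nested sums. Multiplying by sin^n θ and integrating over (0, π/2) turns the
series of the theorem into ∫ sin^n θ · θ^(2p+s)/(2p+s)! (`hasSum_nestedSum_div`). By Wallis,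
`middleBinom n` normalises sin^n to a probability density that concentrates at π/2, so the limit is
read off from (π/2)^(2p+s). The case s = 0 gives G and odd powers of π; s = 1 gives H and even
powers. -/

open Real in
theorem abs_sin_lt_one_of_mem_Ioo {θ : ℝ} (hθ : θ ∈ Set.Ioo (-(π / 2)) (π / 2)) : |sin θ| < 1 := by
  have h := cos_pos_of_mem_Ioo hθ
  have h2 := sin_sq_add_cos_sq θ
  rw [← sq_lt_one_iff_abs_lt_one]
  nlinarith [pow_pos h 2]

theorem summable_natCast_mul_pow_sub_one {r : ℝ} (h0 : 0 < r) (h1 : r < 1) :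
    Summable fun n : ℕ => (n : ℝ) * r ^ (n - 1) := by
  have h := (summable_pow_mul_geometric_of_norm_lt_one (R := ℝ) 1
    (r := r) (by rwa [Real.norm_eq_abs, abs_of_pos h0])).mul_right r⁻¹
  refine h.congr fun n => ?_
  rcases n with _ | n
  · simp
  · simp only [Nat.add_sub_cancel, pow_succ]
    field_simp

theorem injective_two_mul_add (s : ℕ) : Function.Injective fun k : ℕ => 2 * k + s := by
  intro a b h
  simp only at h
  omega

/-! ### Power series in sin θ with bounded coefficients. -/

theorem summable_mul_deriv_pow {d : ℕ → ℝ} {M : ℝ} (hd : ∀ k, |d k| ≤ M) (s : ℕ) {x : ℝ}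
    (hx : |x| < 1) : Summable fun k : ℕ => d k * (((2 * k + s : ℕ) : ℝ) * x ^ (2 * k + s - 1)) := by
  have hr0 : 0 < (|x| + 1) / 2 := by positivity
  have h := ((summable_natCast_mul_pow_sub_one hr0 (by linarith)).comp_injective
    (injective_two_mul_add s)).mul_left M
  refine Summable.of_norm_bounded h fun k => ?_
  simp only [Function.comp, norm_mul, norm_pow, Real.norm_eq_abs, Nat.abs_cast]
  have h0 : 0 ≤ M := (abs_nonneg _).trans (hd 0)
  gcongr
  · exact hd k
  · linarith

theorem summable_mul_pow {d : ℕ → ℝ} {M : ℝ} (hd : ∀ k, |d k| ≤ M) (s : ℕ) {x : ℝ}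
    (hx : |x| < 1) : Summable fun k : ℕ => d k * x ^ (2 * k + s) := by
  have h := ((summable_geometric_of_lt_one (abs_nonneg x) hx).comp_injective
    (injective_two_mul_add s)).mul_left M
  refine Summable.of_norm_bounded h fun k => ?_
  simp only [Function.comp, norm_mul, norm_pow, Real.norm_eq_abs]
  gcongr
  exact hd k

theorem hasDerivAt_tsum_mul_pow {d : ℕ → ℝ} {M : ℝ} (hd : ∀ k, |d k| ≤ M) (s : ℕ) {x : ℝ}
    (hx : |x| < 1) :
    HasDerivAt (fun y => ∑' k : ℕ, d k * y ^ (2 * k + s))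
      (∑' k : ℕ, d k * (((2 * k + s : ℕ) : ℝ) * x ^ (2 * k + s - 1))) x := by
  -- A radius strictly between |x| and 1 gives a uniform summable bound on the derivatives near x.
  have hr0 : 0 < (|x| + 1) / 2 := by positivity
  have h := ((summable_natCast_mul_pow_sub_one hr0 (by linarith)).comp_injective
    (injective_two_mul_add s)).mul_left M
  refine hasDerivAt_tsum_of_isPreconnected (t := Set.Ioo (-((|x| + 1) / 2)) ((|x| + 1) / 2))
    (y₀ := x) h isOpen_Ioo isPreconnected_Ioo
    (fun k y _ => (hasDerivAt_pow (2 * k + s) y).const_mul (d k)) ?_ ?_ (summable_mul_pow hd s hx) ?_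
  · intro k y hy
    simp only [Function.comp, norm_mul, norm_pow, Real.norm_eq_abs, Nat.abs_cast]
    have h0 : 0 ≤ M := (abs_nonneg _).trans (hd 0)
    gcongr
    · exact hd k
    · exact (abs_lt.2 hy).le
  all_goals
    rw [Set.mem_Ioo, ← abs_lt]
    linarith

open Real in
theorem hasDerivAt_tsum_mul_sin_pow {c : ℕ → ℝ} {M : ℝ} (hc : ∀ k, |c k| ≤ M) (s : ℕ) {θ : ℝ}
    (hθ : θ ∈ Set.Ioo (-(π / 2)) (π / 2)) :
    HasDerivAt (fun t => ∑' k : ℕ, c k / (2 * k + 1 + s) * sin t ^ (2 * k + (s + 1)))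
      (cos θ * ∑' k : ℕ, c k * sin θ ^ (2 * k + s)) θ := by
  have hd : ∀ k : ℕ, |c k / (2 * k + 1 + s)| ≤ M := fun k => by
    rw [abs_div]
    refine (div_le_self (abs_nonneg _) ?_).trans (hc k)
    rw [abs_of_pos (by positivity)]
    nlinarith [Nat.cast_nonneg (α := ℝ) k, Nat.cast_nonneg (α := ℝ) s]
  have h := (hasDerivAt_tsum_mul_pow hd (s + 1) (abs_sin_lt_one_of_mem_Ioo hθ)).comp θ
    (hasDerivAt_sin θ)
  convert! h using 1
  rw [mul_comm]
  congr 1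
  refine tsum_congr fun k => ?_
  rw [show 2 * k + (s + 1) - 1 = 2 * k + s by omega]
  push_cast
  have : (2 * (k : ℝ) + 1 + s) ≠ 0 := by positivity
  field_simp
  ring

-- Replacing cos² by 1 - sin² makes the derivative a power series in sin θ, whose coefficients `hdc`
-- collapses. The leading k = 0 term survives separately; for s = 0 its factor s kills the truncated
-- exponent s - 1.
open Real in
theorem hasDerivAt_cos_mul_tsum_mul_sin_pow {d c : ℕ → ℝ} {M : ℝ} (hd : ∀ k, |d k| ≤ M) (s : ℕ)
    (hdc : ∀ k : ℕ, (2 * k + 2 + s) * d (k + 1) = (2 * k + 1 + s) * d k + c k / (2 * k + 1 + s))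
    {θ : ℝ} (hθ : θ ∈ Set.Ioo (-(π / 2)) (π / 2)) :
    HasDerivAt (fun t => cos t * ∑' k : ℕ, d k * sin t ^ (2 * k + s))
      (s * d 0 * sin θ ^ (s - 1) + ∑' k : ℕ, c k / (2 * k + 1 + s) * sin θ ^ (2 * k + (s + 1))) θ := by
  have hx := abs_sin_lt_one_of_mem_Ioo hθ
  have h := (hasDerivAt_cos θ).mul
    ((hasDerivAt_tsum_mul_pow hd s hx).comp θ (hasDerivAt_sin θ))
  convert! h using 1
  simp only [Function.comp]
  have hcos : cos θ ^ 2 = 1 - sin θ ^ 2 := by linarith [sin_sq_add_cos_sq θ]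
  generalize sin θ = x at *
  have S0 := (summable_mul_pow hd s hx)
  have S1 := (summable_mul_deriv_pow hd s hx)
  have hterm : ∀ k : ℕ, x * (d k * x ^ (2 * k + s)) +
      x ^ 2 * (d k * (((2 * k + s : ℕ) : ℝ) * x ^ (2 * k + s - 1))) =
      (2 * k + 1 + s) * d k * x ^ (2 * k + (s + 1)) := fun k => by
    rw [← add_assoc, pow_succ]
    rcases h : 2 * k + s with _ | m
    · obtain ⟨rfl, rfl⟩ : k = 0 ∧ s = 0 := by omega
      simp [mul_comm]
    · have : (2 * (k : ℝ) + 1 + s) = m + 2 := by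
        have : ((2 * k + s : ℕ) : ℝ) = (m + 1 : ℕ) := by rw [h]
        push_cast at this
        linarith
      rw [this]
      simp only [Nat.add_sub_cancel]
      push_cast
      ring
  have e0 : x * (∑' k : ℕ, d k * x ^ (2 * k + s)) +
      x ^ 2 * (∑' k : ℕ, d k * (((2 * k + s : ℕ) : ℝ) * x ^ (2 * k + s - 1))) =
      ∑' k : ℕ, (2 * k + 1 + s) * d k * x ^ (2 * k + (s + 1)) := by
    rw [← tsum_mul_left, ← tsum_mul_left, ← (S0.mul_left _).tsum_add (S1.mul_left _)]
    exact tsum_congr hterm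
  have S2 : Summable fun k : ℕ => (2 * k + 1 + s) * d k * x ^ (2 * k + (s + 1)) :=
    ((S0.mul_left x).add (S1.mul_left (x ^ 2))).congr hterm
  have e1 := S1.tsum_eq_zero_add
  have S3 := (summable_nat_add_iff 1).2 S1
  have e2 : ∑' k : ℕ, c k / (2 * k + 1 + s) * x ^ (2 * k + (s + 1)) =
      (∑' k : ℕ, d (k + 1) * (((2 * (k + 1) + s : ℕ) : ℝ) * x ^ (2 * (k + 1) + s - 1))) -
      ∑' k : ℕ, (2 * k + 1 + s) * d k * x ^ (2 * k + (s + 1)) := by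
    rw [← S3.tsum_sub S2]
    refine tsum_congr fun k => ?_
    rw [show 2 * (k + 1) + s - 1 = 2 * k + (s + 1) by omega]
    push_cast
    linear_combination x ^ (2 * k + (s + 1)) * -hdc k
  rw [e2, ← e0]
  rw [show 2 * 0 + s = s by omega] at e1
  linear_combination (-1 : ℝ) * e1 - (∑' k : ℕ, d k * (((2 * k + s : ℕ) : ℝ) * x ^ (2 * k + s - 1))) * hcos

open Real in
theorem eqOn_of_hasDerivAt_Ioo {f g f' : ℝ → ℝ}
    (hf : ∀ θ ∈ Set.Ioo (-(π / 2)) (π / 2), HasDerivAt f (f' θ) θ)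
    (hg : ∀ θ ∈ Set.Ioo (-(π / 2)) (π / 2), HasDerivAt g (f' θ) θ) (h0 : f 0 = g 0) :
    Set.EqOn f g (Set.Ioo (-(π / 2)) (π / 2)) := by
  refine isOpen_Ioo.eqOn_of_deriv_eq isPreconnected_Ioo
    (fun θ h => (hf θ h).differentiableAt.differentiableWithinAt)
    (fun θ h => (hg θ h).differentiableAt.differentiableWithinAt)
    (fun θ h => by rw [(hf θ h).deriv, (hg θ h).deriv]) (x := 0) ?_ h0
  constructor <;> linarith [pi_pos]

theorem hasDerivAt_pow_div_factorial (m : ℕ) (x : ℝ) :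
    HasDerivAt (fun t : ℝ => t ^ (m + 1) / (m + 1).factorial) (x ^ m / m.factorial) x := by
  convert! (hasDerivAt_pow (m + 1) x).div_const ((m + 1).factorial : ℝ) using 1
  rw [Nat.factorial_succ]
  have := Nat.factorial_pos m
  push_cast
  field_simp

-- One integration of `h` gives the series with coefficients c_k/(2k+1+s); by `hdc` and d_0 = 0 that
-- series is the derivative of the left side for d, so a second integration concludes.
open Real in
theorem cos_mul_tsum_eq_pow_div_factorial_step {d c : ℕ → ℝ} {M N : ℝ} (hd : ∀ k, |d k| ≤ M)
    (hc : ∀ k, |c k| ≤ N) (s m : ℕ) (d0 : d 0 = 0)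
    (hdc : ∀ k : ℕ, (2 * k + 2 + s) * d (k + 1) = (2 * k + 1 + s) * d k + c k / (2 * k + 1 + s))
    (h : ∀ θ ∈ Set.Ioo (-(π / 2)) (π / 2),
      cos θ * ∑' k : ℕ, c k * sin θ ^ (2 * k + s) = θ ^ m / m.factorial) :
    ∀ θ ∈ Set.Ioo (-(π / 2)) (π / 2),
      cos θ * ∑' k : ℕ, d k * sin θ ^ (2 * k + s) = θ ^ (m + 2) / (m + 2).factorial := by
  have hV := eqOn_of_hasDerivAt_Ioo (fun θ hθ => hasDerivAt_tsum_mul_sin_pow hc s hθ)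
    (fun θ hθ => (h θ hθ) ▸ hasDerivAt_pow_div_factorial m θ) (by simp)
  refine eqOn_of_hasDerivAt_Ioo (fun θ hθ => hasDerivAt_cos_mul_tsum_mul_sin_pow hd s hdc hθ)
    (fun θ hθ => ?_) ?_
  · have hV' : ∑' k : ℕ, c k / (2 * k + 1 + s) * sin θ ^ (2 * k + (s + 1)) =
        θ ^ (m + 1) / (m + 1).factorial := hV hθ
    rw [d0, mul_zero, zero_mul, zero_add, hV']
    exact hasDerivAt_pow_div_factorial (m + 1) θ
  · have : ∀ k : ℕ, d k * sin 0 ^ (2 * k + s) = 0 := by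
      rintro (_ | k)
      · simp [d0]
      · rw [sin_zero, zero_pow (by omega), mul_zero]
    simp only [this]
    simp

/-! ### Coefficients and the key identity. -/

/-- The Taylor coefficients of `1 / √(1 - x²)` (for `s = 0`) and of `arcsin x / √(1 - x²)`
(for `s = 1`). -/
noncomputable def arcsinCoeff (s : ℕ) : ℕ → ℝ
  | 0 => 1
  | k + 1 => (2 * k + 1 + s) / (2 * k + 2 + s) * arcsinCoeff s k

/-- The common form of `arcsinG` (for `s = 0`) and of the shifted `arcsinH` (for `s = 1`). -/
noncomputable def nestedSum (s : ℕ) : ℕ → ℕ → ℝ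
  | 0, _ => 1
  | p + 1, k => ∑ j ∈ Finset.range k, 1 / (2 * (j : ℝ) + 1 + s) ^ 2 * nestedSum s p j

theorem arcsinCoeff_nonneg (s k : ℕ) : 0 ≤ arcsinCoeff s k := by
  induction k with
  | zero => simp [arcsinCoeff]
  | succ k ih => rw [arcsinCoeff]; positivity

theorem arcsinCoeff_le_one (s k : ℕ) : arcsinCoeff s k ≤ 1 := by
  induction k with
  | zero => simp [arcsinCoeff]
  | succ k ih =>
    rw [arcsinCoeff]
    refine mul_le_one₀ ?_ (arcsinCoeff_nonneg s k) ih
    rw [div_le_one (by positivity)]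
    linarith

theorem nestedSum_nonneg (s p k : ℕ) : 0 ≤ nestedSum s p k := by
  induction p generalizing k with
  | zero => simp [nestedSum]
  | succ p ih =>
    rw [nestedSum]
    exact Finset.sum_nonneg fun j _ => mul_nonneg (by positivity) (ih j)

theorem sum_one_div_sq_le_two (s k : ℕ) :
    ∑ j ∈ Finset.range k, 1 / (2 * (j : ℝ) + 1 + s) ^ 2 ≤ 2 := by
  -- Strengthened to a telescoping bound so that induction applies.
  suffices h : ∑ j ∈ Finset.range k, 1 / (2 * (j : ℝ) + 1 + s) ^ 2 ≤ 2 - 2 / ((k : ℝ) + 1) from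
    h.trans (sub_le_self _ (by positivity))
  induction k with
  | zero => simp
  | succ k ih =>
    rw [Finset.sum_range_succ]
    have h1 : 1 / (2 * (k : ℝ) + 1 + s) ^ 2 ≤ 2 / ((k : ℝ) + 1) - 2 / ((k : ℝ) + 1 + 1) := by
      rw [div_sub_div _ _ (by positivity) (by positivity),
        div_le_div_iff₀ (by positivity) (by positivity)]
      have hk : (0 : ℝ) ≤ k := k.cast_nonneg
      have hs : (0 : ℝ) ≤ s := s.cast_nonneg
      nlinarith [mul_nonneg hk hs, mul_nonneg hs hs, mul_nonneg hk hk]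
    push_cast
    linarith

theorem nestedSum_le (s p k : ℕ) : nestedSum s p k ≤ 2 ^ p := by
  induction p generalizing k with
  | zero => simp [nestedSum]
  | succ p ih =>
    rw [nestedSum, pow_succ']
    refine (Finset.sum_le_sum fun j _ => mul_le_mul_of_nonneg_left (ih j) (by positivity)).trans ?_
    rw [← Finset.sum_mul]
    exact mul_le_mul_of_nonneg_right (sum_one_div_sq_le_two s k) (by positivity)

theorem abs_arcsinCoeff_mul_nestedSum_le (s p k : ℕ) :
    |arcsinCoeff s k * nestedSum s p k| ≤ 2 ^ p := by
  rw [abs_of_nonneg (mul_nonneg (arcsinCoeff_nonneg s k) (nestedSum_nonneg s p k))]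
  calc _ ≤ 1 * (2 : ℝ) ^ p := mul_le_mul (arcsinCoeff_le_one s k) (nestedSum_le s p k)
        (nestedSum_nonneg s p k) zero_le_one
    _ = _ := one_mul _

theorem arcsinCoeff_succ (s k : ℕ) :
    (2 * k + 2 + s) * arcsinCoeff s (k + 1) = (2 * k + 1 + s) * arcsinCoeff s k := by
  rw [arcsinCoeff]
  field_simp

theorem nestedSum_succ_succ (s p k : ℕ) :
    nestedSum s (p + 1) (k + 1) =
      nestedSum s (p + 1) k + 1 / (2 * (k : ℝ) + 1 + s) ^ 2 * nestedSum s p k := by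
  simp only [nestedSum, Finset.sum_range_succ]

open Real in
theorem cos_mul_tsum_nestedSum_eq {s : ℕ} (hs : s ≤ 1) (p : ℕ) :
    ∀ θ ∈ Set.Ioo (-(π / 2)) (π / 2),
      cos θ * ∑' k : ℕ, arcsinCoeff s k * nestedSum s p k * sin θ ^ (2 * k + s) =
        θ ^ (2 * p + s) / (2 * p + s).factorial := by
  induction p with
  | zero =>
    -- With c = 0 only the leading term of the derivative remains: 0 for s = 0 and 1 for s = 1.
    refine eqOn_of_hasDerivAt_Ioo (fun θ hθ => hasDerivAt_cos_mul_tsum_mul_sin_pow (c := 0)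
      (abs_arcsinCoeff_mul_nestedSum_le s 0) s (fun k => ?_) hθ) (fun θ hθ => ?_) ?_
    · simp [nestedSum, arcsinCoeff_succ]
    · interval_cases s
      · simpa using hasDerivAt_const θ (1 : ℝ)
      · simpa [arcsinCoeff, nestedSum] using hasDerivAt_id' θ
    · interval_cases s
      · rw [tsum_eq_single 0]
        · simp [arcsinCoeff, nestedSum]
        · intro k hk
          rw [sin_zero, zero_pow (by omega), mul_zero]
      · simp
  | succ p ih =>
    have h := cos_mul_tsum_eq_pow_div_factorial_step
      (abs_arcsinCoeff_mul_nestedSum_le s (p + 1)) (abs_arcsinCoeff_mul_nestedSum_le s p) s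
      (2 * p + s) (by simp [nestedSum]) (fun k => ?_) ih
    · rwa [show 2 * (p + 1) + s = 2 * p + s + 2 by ring]
    · rw [nestedSum_succ_succ, ← mul_assoc, arcsinCoeff_succ]
      field_simp

/-! ### Termwise integration. -/

open Real MeasureTheory

theorem integral_sin_pow_mul_cos (m : ℕ) :
    ∫ θ in (0 : ℝ)..(π / 2), sin θ ^ m * cos θ = 1 / (m + 1) := by
  have h := @integral_sin_pow_mul_cos_pow_odd 0 (π / 2) m 0
  simpa using h

theorem hasSum_nestedSum_div {s : ℕ} (hs : s ≤ 1) (p n : ℕ) :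
    HasSum (fun k : ℕ => arcsinCoeff s k * nestedSum s p k / (2 * k + s + n + 1))
      (∫ θ in (0 : ℝ)..(π / 2), sin θ ^ n * (θ ^ (2 * p + s) / (2 * p + s).factorial)) := by
  set c : ℕ → ℝ := fun k => arcsinCoeff s k * nestedSum s p k with hc
  have hc0 : ∀ k, 0 ≤ c k := fun k => mul_nonneg (arcsinCoeff_nonneg s k) (nestedSum_nonneg s p k)
  set F : ℕ → ℝ → ℝ := fun k θ => c k * (sin θ ^ (2 * k + s + n) * cos θ) with hF
  have hpi : (0 : ℝ) ≤ π / 2 := by positivity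
  have hFc : ∀ k, Continuous (F k) := fun k => by simp only [hF]; fun_prop
  have hFi : ∀ k, ∫ θ in (0 : ℝ)..(π / 2), F k θ = c k / (2 * k + s + n + 1) := fun k => by
    simp only [hF]
    rw [intervalIntegral.integral_const_mul, integral_sin_pow_mul_cos]
    push_cast
    ring
  have hF0 : ∀ k, ∀ θ ∈ Set.Ioo 0 (π / 2), 0 ≤ F k θ := fun k θ hθ => by
    have h1 := sin_nonneg_of_nonneg_of_le_pi hθ.1.le (by linarith [hθ.2])
    have h2 := cos_nonneg_of_mem_Icc (x := θ) ⟨by linarith [hθ.1], hθ.2.le⟩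
    have := hc0 k
    positivity
  have hFs : ∀ θ ∈ Set.Ioo 0 (π / 2), HasSum (fun k => F k θ)
      (sin θ ^ n * (θ ^ (2 * p + s) / (2 * p + s).factorial)) := fun θ hθ => by
    have hθ' : θ ∈ Set.Ioo (-(π / 2)) (π / 2) := ⟨by linarith [hθ.1], hθ.2⟩
    rw [← cos_mul_tsum_nestedSum_eq hs p θ hθ']
    have h := (summable_mul_pow (abs_arcsinCoeff_mul_nestedSum_le s p) s
      (abs_sin_lt_one_of_mem_Ioo hθ')).hasSum.mul_left (sin θ ^ n * cos θ)
    rw [← mul_assoc]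
    convert! h using 2
    simp only [hF, hc]
    ring
  have hint : ∀ k, IntervalIntegrable (F k) volume 0 (π / 2) := fun k =>
    (hFc k).intervalIntegrable _ _
  -- The terms are nonnegative and the integral of the full sum bounds every partial sum; this
  -- summability then licenses the exchange of sum and integral.
  have hsum : Summable fun k : ℕ => c k / (2 * k + s + n + 1) := by
    refine summable_of_sum_range_le
      (c := ∫ θ in (0 : ℝ)..(π / 2), sin θ ^ n * (θ ^ (2 * p + s) / (2 * p + s).factorial))
      (fun k => div_nonneg (hc0 k) (by positivity)) fun K => ?_
    simp only [← hFi]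
    rw [← intervalIntegral.integral_finsetSum fun k _ => hint k]
    refine intervalIntegral.integral_mono_on_of_le_Ioo hpi ?_ ?_ fun θ hθ => ?_
    · exact (continuous_finsetSum _ fun k _ => hFc k).intervalIntegrable _ _
    · exact Continuous.intervalIntegrable (by fun_prop) _ _
    · exact sum_le_hasSum _ (fun k _ => hF0 k θ hθ) (hFs θ hθ)
  simp only [intervalIntegral.integral_of_le hpi, integral_Ioc_eq_integral_Ioo] at hFi ⊢
  have key := hasSum_integral_of_summable_integral_norm (μ := volume.restrict (Set.Ioo 0 (π / 2)))
    (F := F) (fun k => ((hint k).1.mono_set Set.Ioo_subset_Ioc_self)) ?_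
  · simp only [hFi] at key
    convert! key using 1
    exact setIntegral_congr_fun measurableSet_Ioo fun θ hθ => (hFs θ hθ).tsum_eq.symm
  · refine hsum.congr fun k => ?_
    rw [← hFi]
    exact setIntegral_congr_fun measurableSet_Ioo fun θ hθ => (norm_of_nonneg (hF0 k θ hθ)).symm

/-! ### Wallis integrals and concentration at π/2. -/

theorem middleBinom_add_two (n : ℕ) :
    middleBinom (n + 2) = 4 * ((n + 1) / (n + 2)) * middleBinom n := by
  have h1 : Gamma ((n + 2 : ℕ) + 1) = (n + 2) * ((n + 1) * Gamma ((n : ℝ) + 1)) := by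
    rw [← Gamma_add_one (by positivity)]
    have : (n : ℝ) + 2 = n + 1 + 1 := by ring
    rw [this, ← Gamma_add_one (by positivity)]
    congr 1
    push_cast
    ring
  have h2 : Gamma (((n + 2 : ℕ) : ℝ) / 2 + 1) = ((n : ℝ) / 2 + 1) * Gamma ((n : ℝ) / 2 + 1) := by
    rw [← Gamma_add_one (by positivity)]
    congr 1
    push_cast
    ring
  have h3 : Gamma ((n : ℝ) / 2 + 1) ≠ 0 := (Gamma_pos_of_pos (by positivity)).ne'
  rw [middleBinom, middleBinom, h1, h2]
  field_simp
  ring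

theorem middleBinom_pos (n : ℕ) : 0 < middleBinom n :=
  div_pos (Gamma_pos_of_pos (by positivity)) (pow_pos (Gamma_pos_of_pos (by positivity)) 2)

theorem integral_sin_pow_eq_middleBinom (n : ℕ) :
    ∫ θ in (0 : ℝ)..(π / 2), sin θ ^ n = π / 2 * middleBinom n / 2 ^ n := by
  induction n using Nat.twoStepInduction with
  | zero => simp [middleBinom]
  | one =>
    have h : Gamma (1 / 2 + 1) = 1 / 2 * √π := by
      rw [Gamma_add_one (by norm_num), Gamma_one_half_eq]
    have h2 : Gamma ((1 : ℝ) + 1) = 1 := by simp [one_add_one_eq_two]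
    simp only [middleBinom, pow_one, Nat.cast_one, h, h2, integral_sin, mul_pow, sq_sqrt pi_pos.le]
    simp
    field_simp
  | more n ih _ =>
    rw [integral_sin_pow, ih, middleBinom_add_two]
    simp
    field_simp
    ring

theorem tendsto_integral_sin_pow_mul (m : ℕ) :
    Tendsto (fun n : ℕ => 2 ^ n / middleBinom n * ∫ θ in (0 : ℝ)..(π / 2), sin θ ^ n * θ ^ m)
      atTop (𝓝 ((π / 2) ^ (m + 1))) := by
  have hpi : (0 : ℝ) < π / 2 := by positivity
  have h := tendsto_setIntegral_pow_smul_of_unique_maximum_of_isCompact_of_continuousOn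
    (μ := volume) (s := Set.Icc 0 (π / 2)) (c := sin) (g := fun θ => θ ^ m) (x₀ := π / 2)
    isCompact_Icc continuous_sin.continuousOn ?_ ?_ (by simp) ?_ (by fun_prop)
  · rw [pow_succ']
    refine (h.const_mul (π / 2)).congr fun n => ?_
    simp only [integral_Icc_eq_integral_Ioc, ← intervalIntegral.integral_of_le hpi.le, smul_eq_mul,
      integral_sin_pow_eq_middleBinom]
    have := (middleBinom_pos n).ne'
    field_simp
  · intro y hy hne
    exact sin_lt_sin_of_lt_of_le_pi_div_two (by linarith [hy.1]) le_rfl (lt_of_le_of_ne hy.2 hne)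
  · exact fun y hy => sin_nonneg_of_nonneg_of_le_pi hy.1 (by linarith [hy.2])
  -- The peak is an endpoint, so it lies only in the closure of the interior.
  · rw [interior_Icc, closure_Ioo hpi.ne]
    exact Set.right_mem_Icc.2 hpi.le

theorem tendsto_tsum_nestedSum_div {s : ℕ} (hs : s ≤ 1) (p : ℕ) :
    Tendsto (fun n : ℕ => 2 ^ (2 * p + s + n + 1) * ((2 * p + s).factorial : ℝ) / middleBinom n *
      ∑' k : ℕ, arcsinCoeff s k * nestedSum s p k / (2 * k + s + n + 1))
      atTop (𝓝 (π ^ (2 * p + s + 1))) := by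
  have h := (tendsto_integral_sin_pow_mul (2 * p + s)).const_mul (2 ^ (2 * p + s + 1))
  rw [← mul_pow, mul_div_cancel₀ _ two_ne_zero] at h
  refine h.congr fun n => ?_
  rw [(hasSum_nestedSum_div hs p n).tsum_eq]
  simp only [← mul_div_assoc, intervalIntegral.integral_div]
  have := (middleBinom_pos n).ne'
  have := Nat.factorial_pos (2 * p + s)
  field_simp
  ring

/-! ### Translation to the sums G and H. -/

theorem centralBinom_div_four_pow (k : ℕ) :
    ((2 * k).choose k : ℝ) / 4 ^ k = arcsinCoeff 0 k := by
  induction k with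
  | zero => simp [arcsinCoeff]
  | succ k ih =>
    have h : ((k : ℝ) + 1) * ((2 * (k + 1)).choose (k + 1) : ℝ) =
        2 * (2 * k + 1) * ((2 * k).choose k : ℝ) := by
      exact_mod_cast Nat.succ_mul_centralBinom_succ k
    rw [arcsinCoeff, ← ih, pow_succ]
    field_simp
    push_cast
    linear_combination 2 * h

/-- The factor 2 in the denominator normalises the value at k = 0 to 1; it reappears as the factor 2
in `arcsinH_summand_eq`. -/
theorem four_pow_div_centralBinom (k : ℕ) :
    (4 : ℝ) ^ (k + 1) / (((2 * (k + 1)).choose (k + 1) : ℝ) * (2 * (k + 1))) =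
      arcsinCoeff 1 k := by
  induction k with
  | zero => norm_num [arcsinCoeff, Nat.choose]
  | succ k ih =>
    have h : ((k : ℝ) + 1 + 1) * ((2 * (k + 1 + 1)).choose (k + 1 + 1) : ℝ) =
        2 * (2 * (k + 1) + 1) * ((2 * (k + 1)).choose (k + 1) : ℝ) := by
      exact_mod_cast Nat.succ_mul_centralBinom_succ (k + 1)
    have h0 : ((2 * (k + 1)).choose (k + 1) : ℝ) ≠ 0 := by
      exact_mod_cast (Nat.centralBinom_pos (k + 1)).ne'
    have h1 : ((2 * (k + 1 + 1)).choose (k + 1 + 1) : ℝ) ≠ 0 := by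
      exact_mod_cast (Nat.centralBinom_pos (k + 1 + 1)).ne'
    rw [arcsinCoeff, ← ih, pow_succ]
    rw [div_mul_div_comm, div_eq_div_iff (by positivity) (by positivity)]
    push_cast
    linear_combination (-(4 : ℝ) ^ (k + 1) * (2 * k + 2) * 2) * h

theorem arcsinG_eq_nestedSum (p k : ℕ) : arcsinG p k = nestedSum 0 p k := by
  induction p generalizing k with
  | zero => rfl
  | succ p ih => simp [arcsinG, nestedSum, ih]

theorem arcsinH_succ_eq_nestedSum (p k : ℕ) : arcsinH (p + 1) (k + 1) = nestedSum 1 p k := by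
  induction p generalizing k with
  | zero => rfl
  | succ p ih =>
    rw [arcsinH, nestedSum, Finset.sum_Ico_eq_sum_range]
    refine Finset.sum_congr rfl fun j _ => ?_
    rw [add_comm 1 j, ih]
    push_cast
    ring

theorem arcsinG_summand_eq (p n k : ℕ) :
    ((2 * k).choose k : ℝ) * arcsinG p k / ((4 : ℝ) ^ k * (2 * (k : ℝ) + n + 1)) =
      arcsinCoeff 0 k * nestedSum 0 p k / (2 * k + (0 : ℕ) + n + 1) := by
  rw [← centralBinom_div_four_pow, arcsinG_eq_nestedSum, Nat.cast_zero, add_zero]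
  field_simp

theorem arcsinH_summand_eq (p n k : ℕ) :
    (4 : ℝ) ^ (k + 1) * arcsinH (p + 1) (k + 1) /
        (((2 * (k + 1)).choose (k + 1) : ℝ) * ((k + 1 : ℕ) : ℝ) *
          (2 * ((k + 1 : ℕ) : ℝ) + n)) =
      2 * (arcsinCoeff 1 k * nestedSum 1 p k / (2 * k + (1 : ℕ) + n + 1)) := by
  have h0 : ((2 * (k + 1)).choose (k + 1) : ℝ) ≠ 0 := by
    exact_mod_cast (Nat.centralBinom_pos (k + 1)).ne'
  rw [← four_pow_div_centralBinom, arcsinH_succ_eq_nestedSum]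
  have : (2 * (k : ℝ) + (1 : ℕ) + n + 1) = 2 * ((k + 1 : ℕ) : ℝ) + n := by push_cast; ring
  rw [this]
  push_cast
  field_simp

theorem hasSum_arcsinH (p n : ℕ) :
    HasSum (fun k : ℕ+ => (4 : ℝ) ^ (k : ℕ) * arcsinH (p + 1) k /
        (((2 * (k : ℕ)).choose k : ℝ) * ((k : ℕ) : ℝ) * (2 * ((k : ℕ) : ℝ) + n)))
      (2 * ∑' k : ℕ, arcsinCoeff 1 k * nestedSum 1 p k / (2 * k + (1 : ℕ) + n + 1)) := by
  rw [← Equiv.pnatEquivNat.symm.hasSum_iff]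
  convert! (hasSum_nestedSum_div le_rfl p n).summable.hasSum.mul_left 2 using 1
  exact funext fun k => arcsinH_summand_eq p n k

theorem theorem4p1 :
    (∀ p : ℕ,
      (∀ n : ℕ, Summable fun k : ℕ =>
        ((2 * k).choose k : ℝ) * arcsinG p k / ((4 : ℝ) ^ k * (2 * (k : ℝ) + n + 1))) ∧
      Tendsto
        (fun n : ℕ =>
          (2 : ℝ) ^ (2 * p + n + 1) * (Nat.factorial (2 * p) : ℝ) / middleBinom n *
            ∑' k : ℕ,
              ((2 * k).choose k : ℝ) * arcsinG p k / ((4 : ℝ) ^ k * (2 * (k : ℝ) + n + 1)))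
        atTop (𝓝 (Real.pi ^ (2 * p + 1)))) ∧
    (∀ p : ℕ, 1 ≤ p →
      (∀ n : ℕ, Summable fun k : ℕ+ =>
        (4 : ℝ) ^ (k : ℕ) * arcsinH p k /
          (((2 * (k : ℕ)).choose k : ℝ) * ((k : ℕ) : ℝ) * (2 * ((k : ℕ) : ℝ) + n))) ∧
      Tendsto
        (fun n : ℕ =>
          (2 : ℝ) ^ (2 * p + n - 1) * (Nat.factorial (2 * p - 1) : ℝ) / middleBinom n *
            ∑' k : ℕ+,
              (4 : ℝ) ^ (k : ℕ) * arcsinH p k /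
                (((2 * (k : ℕ)).choose k : ℝ) * ((k : ℕ) : ℝ) * (2 * ((k : ℕ) : ℝ) + n)))
        atTop (𝓝 (Real.pi ^ (2 * p)))) := by
  refine ⟨fun p => ⟨fun n => ?_, ?_⟩, fun p hp => ?_⟩
  · simp only [arcsinG_summand_eq]
    exact (hasSum_nestedSum_div zero_le_one p n).summable
  · simp only [arcsinG_summand_eq]
    exact tendsto_tsum_nestedSum_div zero_le_one p
  · obtain ⟨p, rfl⟩ : ∃ q, p = q + 1 := ⟨p - 1, by omega⟩
    refine ⟨fun n => (hasSum_arcsinH p n).summable, ?_⟩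
    refine (tendsto_tsum_nestedSum_div le_rfl p).congr fun n => ?_
    rw [(hasSum_arcsinH p n).tsum_eq, show 2 * (p + 1) + n - 1 = 2 * p + n + 1 by omega,
      show 2 * (p + 1) - 1 = 2 * p + 1 by omega]
    ring
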